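/- All actions are continuous actions by homeomorphisms. For a Hausdorff space $X$ let $\Theta^3X$ be the space of subsets of $X$ of cardinality three, with the quotient topology from the space of ordered triples of pairwise distinct points of $X$ (a subspace of $X^3$). An action of a topological group $G$ on a space $Y$ is \emph{proper} if the map $G\times Y\to Y\times Y$, $(g,y)\mapsto(gy,y)$, is proper; an action of $G$ on $X$ is \emph{proper on triples} (has the convergence property) if the induced action of $G$ on $\Theta^3X$ is proper; it is \emph{cocompact} if $X=GK$ for some compact $K\subset X$. \textbf{Attractor sum theorem.} Let a locally compact group $G$ act on a compact Hausdorff space $\Lambda$ with at least three points properly on triples, and on a locally compact Hausdorff space $\Omega$ properly and cocompactly. Then on the disjoint union $\Lambda\sqcup\Omega$ there is a unique compact Hausdorff topology $\tau$ such that $\tau$ induces the original topologies on the subsets $\Lambda$ and $\Omega$, and such that the $G$-action on $(\Lambda\sqcup\Omega,\tau)$ is continuous and proper on triples. -/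

import Mathlib

open scoped Pointwise

/-- The set `Θ³X` of regular non-ordered triples of points of `X`, i.e. of subsets of `X` of
cardinality three. -/
def RegularTriple (X : Type*) : Type _ := {s : Set X // s.ncard = 3}

namespace RegularTriple

/-- The non-ordered triple of the terms of an ordered triple of pairwise distinct points. -/
def ofInjective {X : Type*} (p : {p : Fin 3 → X // Function.Injective p}) : RegularTriple X :=
  ⟨Set.range p.1, by
    rw [← Set.image_univ, Set.ncard_image_of_injective _ p.2, Set.ncard_univ, Nat.card_fin]⟩

/-- The topology of `Θ³X`: the quotient topology of the space of ordered triples of pairwise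
distinct points (a subspace of `X³`) modulo permutations. (The latter being open in `X³` for
Hausdorff `X`, this is the subspace topology of the symmetric cube `X³/S₃`.) -/
instance instTopologicalSpace (X : Type*) [TopologicalSpace X] :
    TopologicalSpace (RegularTriple X) :=
  TopologicalSpace.coinduced ofInjective inferInstance

/-- The induced action on triples: `g • {x, y, z} = {g • x, g • y, g • z}`. -/
instance instMulAction (G X : Type*) [Group G] [MulAction G X] :
    MulAction G (RegularTriple X) where
  smul g s := ⟨g • s.1, (Set.ncard_image_of_injective s.1 (MulAction.injective g)).trans s.2⟩
  one_smul s := Subtype.ext (one_smul G s.1)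
  mul_smul g h s := Subtype.ext (mul_smul g h s.1)

end RegularTriple

/-- An action of `G` on `X` is proper on triples (3-proper) if the induced action of `G` on the
space `Θ³X` is proper, i.e. the map `G × Θ³X → Θ³X × Θ³X`, `(g, t) ↦ (g • t, t)`, is proper. -/
def IsProperOnTriples (G X : Type*) [Group G] [TopologicalSpace G] [TopologicalSpace X]
    [MulAction G X] : Prop :=
  ProperSMul G (RegularTriple X)

/-- An action of `G` on `X` is cocompact if it has a compact generating set: a compact `K` such
that the translates of `K` by the elements of `G` cover `X`. -/
def IsCocompactAction (G X : Type*) [TopologicalSpace X] [SMul G X] : Prop :=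
  ∃ K : Set X, IsCompact K ∧ ⋃ g : G, g • K = Set.univ

/-! On a compact Hausdorff space with at least three points, properness on triples amounts to
convergence dynamics: an ultrafilter on `G` without limit contracts the complement of a point r to a
point a, locally uniformly (`IsProperOnTriples.hasConvergenceDynamics` and its converse). By
cocompactness each ω in Ω is σ(ω)k with k in a fixed compact set. If an ultrafilter H on Ω has no
limit, neither has σ(H), so σ(H) contracts Λ to some a. In any admissible topology σ(H) then
contracts the whole sum to a off a point of Λ, while k stays in Ω; so H must converge to a
(`escapesTo_of_tendsto`), whence uniqueness.

For existence, these forced convergences define the topology. Compactness is then immediate; the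
difficulty is that no further convergences arise (`escapesTo_of_tendsto_inr`). For this, open
subsets of Λ are extended into Ω by testing group elements on three fixed points
(`exists_open_extension`). Properness on Ω makes a independent of σ (`Attracts.exists_of_tendsto`),
which yields a continuous action with convergence dynamics. -/

open Filter Topology Set Function

/-! ### Attraction along filters -/

/-- A filter on `G` attracts `X` to `a` off `r` if `g • x` tends to `a` along it, locally uniformly
in `x ≠ r`. -/
def Attracts {G X : Type*} [SMul G X] [TopologicalSpace X] (l : Filter G) (a r : X) : Prop :=
  ∀ x, x ≠ r → Tendsto (fun p : G × X => p.1 • p.2) (l ×ˢ 𝓝 x) (𝓝 a)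

/-- An action has convergence dynamics if each ultrafilter on `G` without limit attracts `X` to
some point off some point. -/
def HasConvergenceDynamics (G X : Type*) [TopologicalSpace G] [SMul G X] [TopologicalSpace X] :
    Prop :=
  ∀ U : Ultrafilter G, (∀ g, ¬ (U : Filter G) ≤ 𝓝 g) → ∃ a r : X, Attracts (U : Filter G) a r

namespace Attracts

variable {ι G X : Type*} [Group G] [MulAction G X] [TopologicalSpace X]
  {F : Filter ι} {γ δ : ι → G} {a b r s x : X}

/-- Indexing by `F` allows several families in `G` to be followed along one filter. -/
theorem map_iff : Attracts (map γ F) a r ↔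
    ∀ x, x ≠ r → Tendsto (fun p : ι × X => γ p.1 • p.2) (F ×ˢ 𝓝 x) (𝓝 a) := by
  refine forall₂_congr fun x _ => ?_
  rw [show map γ F ×ˢ 𝓝 x = map (Prod.map γ id) (F ×ˢ 𝓝 x) by
    rw [← Filter.prod_map_map_eq', Filter.map_id], tendsto_map'_iff]
  rfl

theorem tendsto (h : Attracts (map γ F) a r) {z : ι → X} (hz : Tendsto z F (𝓝 x)) (hx : x ≠ r) :
    Tendsto (fun i => γ i • z i) F (𝓝 a) :=
  (map_iff.1 h x hx).comp (tendsto_id.prodMk hz)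

theorem tendsto_const (h : Attracts (map γ F) a r) (hx : x ≠ r) :
    Tendsto (fun i => γ i • x) F (𝓝 a) :=
  h.tendsto tendsto_const_nhds hx

theorem mul (h : Attracts (map γ F) a r) (h' : Attracts (map δ F) b s) (hb : b ≠ r) :
    Attracts (map (fun i => γ i * δ i) F) a s := by
  rw [map_iff] at *
  intro x hx
  simp only [mul_smul]
  exact (h b hb).comp (tendsto_fst.prodMk (h' x hx))

theorem unique [T2Space X] (hcard : 3 ≤ ENat.card X) [NeBot F] (h : Attracts (map γ F) a r)
    (h' : Attracts (map γ F) b s) : a = b := by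
  obtain ⟨x, hx, hx'⟩ := ENat.exists_ne_ne_of_three_le hcard r s
  exact tendsto_nhds_unique (h.tendsto_const hx) (h'.tendsto_const hx')

/-- If y ≠ r were a limit of γ⁻¹x' with x' → x ≠ a, applying γ would give x' → a. -/
theorem inv [T2Space X] [CompactSpace X] (h : Attracts (map γ F) a r) :
    Attracts (map (fun i => (γ i)⁻¹) F) r a := by
  rw [map_iff]
  intro x hx
  rw [tendsto_iff_ultrafilter]
  intro Q hQ
  have hQ1 : Tendsto Prod.fst (Q : Filter (ι × X)) F := tendsto_fst.mono_left hQ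
  have hQ2 : Tendsto Prod.snd (Q : Filter (ι × X)) (𝓝 x) := tendsto_snd.mono_left hQ
  obtain ⟨y, -, hy⟩ := isCompact_univ.ultrafilter_le_nhds
    (Q.map fun p => (γ p.1)⁻¹ • p.2) (by simp)
  by_cases hyr : y = r
  · exact hyr ▸ hy
  · have := (map_iff.1 h y hyr).comp (hQ1.prodMk (show Tendsto _ (Q : Filter (ι × X)) _ from hy))
    refine absurd (tendsto_nhds_unique (hQ2.congr fun p => ?_) this) hx
    simp

variable [TopologicalSpace G] [ContinuousSMul G X] {k : G}

theorem mul_left (h : Attracts (map γ F) a r) (hδ : Tendsto δ F (𝓝 k)) :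
    Attracts (map (fun i => δ i * γ i) F) (k • a) r := by
  rw [map_iff] at *
  intro x hx
  simp only [mul_smul]
  exact (hδ.comp tendsto_fst).smul (h x hx)

theorem mul_right (h : Attracts (map γ F) a r) (hδ : Tendsto δ F (𝓝 k)) :
    Attracts (map (fun i => γ i * δ i) F) a (k⁻¹ • r) := by
  rw [map_iff] at *
  intro x hx
  simp only [mul_smul]
  have hx' : k • x ≠ r := fun e => hx (by rw [← e, inv_smul_smul])
  exact (h _ hx').comp (tendsto_fst.prodMk ((hδ.comp tendsto_fst).smul tendsto_snd))

theorem not_tendsto [T2Space X] (hcard : 3 ≤ ENat.card X) [NeBot F] (h : Attracts (map γ F) a r) :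
    ¬ Tendsto γ F (𝓝 k) := by
  intro hk
  obtain ⟨x, hx, -⟩ := ENat.exists_ne_ne_of_three_le hcard r r
  obtain ⟨y, hy, hxy⟩ := ENat.exists_ne_ne_of_three_le hcard r x
  have key : ∀ z, z ≠ r → k • z = a := fun z hz =>
    tendsto_nhds_unique (hk.smul tendsto_const_nhds) (h.tendsto_const hz)
  exact hxy (MulAction.injective k ((key y hy).trans (key x hx).symm))

end Attracts

/-! ### Properness on triples and convergence dynamics -/

/-- A relation on a set with at least three points, total on both sides and without three pairs
with distinct first and distinct second terms, is contained in a cross. -/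
theorem exists_cross {X : Type*} (hcard : 3 ≤ ENat.card X) {R : X → X → Prop}
    (hl : ∀ x, ∃ y, R x y) (hr : ∀ y, ∃ x, R x y)
    (h3 : ∀ x y : Fin 3 → X, Injective x → Injective y → ¬ ∀ i, R (x i) (y i)) :
    ∃ a r, ∀ x y, R x y → x ≠ r → y = a := by
  have h3' : ∀ x₁ x₂ x₃ y₁ y₂ y₃, R x₁ y₁ → R x₂ y₂ → R x₃ y₃ → x₁ ≠ x₂ → x₁ ≠ x₃ → x₂ ≠ x₃ →
      y₁ ≠ y₂ → y₁ ≠ y₃ → y₂ ≠ y₃ → False := by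
    intro x₁ x₂ x₃ y₁ y₂ y₃ h1 h2 h3'' a b c d e f
    refine h3 ![x₁, x₂, x₃] ![y₁, y₂, y₃] ?_ ?_ ?_
    · intro i j; fin_cases i <;> fin_cases j <;> simp_all [eq_comm]
    · intro i j; fin_cases i <;> fin_cases j <;> simp_all [eq_comm]
    · intro i; fin_cases i <;> simpa
  -- The cross is the row of y₁ and the column of x₂. Each holds two pairs, so a pair outside it
  -- could be completed to three pairs in general position.
  have key : ∀ x₁ x₂ x₃ y₁ y₂ y₃, R x₁ y₁ → R x₂ y₂ → R x₃ y₁ → R x₂ y₃ → x₁ ≠ x₂ → x₃ ≠ x₁ →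
      x₃ ≠ x₂ → y₁ ≠ y₂ → y₃ ≠ y₁ → y₃ ≠ y₂ → ∃ a r, ∀ x y, R x y → x ≠ r → y = a := by
    intro x₁ x₂ x₃ y₁ y₂ y₃ h11 h22 h31 h23 n1 n2 n3 m1 m2 m3
    refine ⟨y₁, x₂, fun x y hxy hx => ?_⟩
    by_contra hy
    have e1 := h3' x x₃ x₂ y y₁ y₃ hxy h31 h23
    have e2 := h3' x x₃ x₂ y y₁ y₂ hxy h31 h22
    have e3 := h3' x x₁ x₂ y y₁ y₃ hxy h11 h23
    have e4 := h3' x x₁ x₂ y y₁ y₂ hxy h11 h22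
    clear hl hr h3 h3' h11 h22 h31 h23 hxy
    by_cases e : x = x₃ <;> by_cases e' : y = y₃ <;> grind
  obtain ⟨x₁, x₂, y₁, y₂, h11, h22, n1, m1⟩ :
      ∃ x₁ x₂ y₁ y₂, R x₁ y₁ ∧ R x₂ y₂ ∧ x₁ ≠ x₂ ∧ y₁ ≠ y₂ := by
    by_contra! hcon
    obtain ⟨x⟩ : Nonempty X := (ENat.one_le_card_iff_nonempty X).1 (le_trans (by norm_num) hcard)
    obtain ⟨x', hx', -⟩ := ENat.exists_ne_ne_of_three_le hcard x x
    obtain ⟨y, hy⟩ := hl x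
    obtain ⟨y', hy', -⟩ := ENat.exists_ne_ne_of_three_le hcard y y
    obtain ⟨z, hz⟩ := hr y'
    obtain ⟨w, hw⟩ := hl x'
    have := hcon x x' y w hy hw
    have := hcon x z y y' hy hz
    have := hcon x' z w y' hw hz
    clear hl hr h3 h3' hcon
    grind
  obtain ⟨x₃, n2, n3⟩ := ENat.exists_ne_ne_of_three_le hcard x₁ x₂
  obtain ⟨y₃, m2, m3⟩ := ENat.exists_ne_ne_of_three_le hcard y₁ y₂
  obtain ⟨v, hv⟩ := hl x₃
  obtain ⟨u, hu⟩ := hr y₃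
  have e1 := h3' x₁ x₂ x₃ y₁ y₂ v h11 h22 hv n1 n2.symm n3.symm m1
  have e2 := h3' x₁ x₂ u y₁ y₂ y₃ h11 h22 hu n1
  have hv' : v = y₁ ∨ v = y₂ := by clear hl hr h3 h3' key; grind
  have hu' : u = x₁ ∨ u = x₂ := by clear hl hr h3 h3' key; grind
  -- In the mixed cases `key` gives the cross; in the other two there are three pairs in general
  -- position.
  rcases hv' with rfl | rfl <;> rcases hu' with rfl | rfl
  · exact (h3' x₃ u x₂ v y₃ y₂ hv hu h22 n2 n3 n1 m2.symm m1 m3).elim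
  · exact key x₁ u x₃ v y₂ y₃ h11 h22 hv hu n1 n2 n3 m1 m2 m3
  · exact key x₂ u x₃ v y₁ y₃ h22 h11 hv hu n1.symm n3 n2 m1.symm m3 m2
  · exact (h3' x₃ u x₁ v y₃ y₁ hv hu h11 n3 n2 n1.symm m3.symm m1.symm m2).elim

theorem exists_ne_ne_of_injective_fin_three {X : Type*} {x : Fin 3 → X} (hx : Injective x) (r : X) :
    ∃ i j, i ≠ j ∧ x i ≠ r ∧ x j ≠ r := by
  by_cases h0 : x 0 = r
  · exact ⟨1, 2, by decide, h0 ▸ hx.ne (by decide), h0 ▸ hx.ne (by decide)⟩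
  · by_cases h1 : x 1 = r
    · exact ⟨0, 2, by decide, h0, h1 ▸ hx.ne (by decide)⟩
    · exact ⟨0, 1, by decide, h0, h1⟩

theorem eventually_injective {ι X : Type*} [Finite ι] [TopologicalSpace X] [T2Space X]
    {x : ι → X} (hx : Injective x) : ∀ᶠ z in 𝓝 x, Injective z := by
  have : ∀ᶠ z in 𝓝 x, ∀ i j, i ≠ j → z i ≠ z j := by
    simp only [eventually_all]
    intro i j hij
    exact (isOpen_ne_fun (continuous_apply i) (continuous_apply j)).mem_nhds (hx.ne hij)
  filter_upwards [this] with z hz i j h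
  by_contra hij
  exact hz i j hij h

/-- Openness makes the image of each neighbourhood of y meet w along `V`. It serves to order
convergent triples. -/
theorem exists_ultrafilter_lift {W Y Z : Type*} [TopologicalSpace Y] [TopologicalSpace Z]
    {f : Y → Z} (hf : IsOpenMap f) (V : Ultrafilter W) {w : W → Z} {y : Y}
    (hw : Tendsto w V (𝓝 (f y))) :
    ∃ Q : Ultrafilter (W × Y), Tendsto Prod.fst (Q : Filter (W × Y)) V ∧
      Tendsto Prod.snd (Q : Filter (W × Y)) (𝓝 y) ∧ ∀ᶠ q in (Q : Filter (W × Y)), f q.2 = w q.1 := by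
  have : NeBot (((V : Filter W) ×ˢ 𝓝 y) ⊓ 𝓟 {q | f q.2 = w q.1}) := by
    rw [inf_principal_neBot_iff]
    intro S hS
    obtain ⟨A, hA, B, hB, hAB⟩ := mem_prod_iff.1 hS
    obtain ⟨v, hvA, b, hb, hv⟩ :=
      V.nonempty_of_mem (inter_mem hA (hw (hf.image_mem_nhds hB)))
    exact ⟨(v, b), hAB ⟨hvA, hb⟩, hv⟩
  obtain ⟨Q, hQ⟩ := Ultrafilter.exists_le (((V : Filter W) ×ˢ 𝓝 y) ⊓ 𝓟 {q | f q.2 = w q.1})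
  exact ⟨Q, tendsto_fst.mono_left (hQ.trans inf_le_left),
    tendsto_snd.mono_left (hQ.trans inf_le_left), le_principal_iff.1 (hQ.trans inf_le_right)⟩

namespace RegularTriple

section

theorem surjective_ofInjective {X : Type*} : Surjective (ofInjective (X := X)) := by
  rintro ⟨s, hs⟩
  obtain ⟨a, b, c, hab, hac, hbc, rfl⟩ := Set.ncard_eq_three.1 hs
  refine ⟨⟨![a, b, c], ?_⟩, Subtype.ext ?_⟩
  · intro i j; fin_cases i <;> fin_cases j <;> simp_all [eq_comm]
  · simp only [ofInjective, Matrix.range_cons, Matrix.range_empty, Set.union_empty]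
    rfl

variable {G X : Type*} [Group G] [MulAction G X]

theorem smul_ofInjective (g : G) (p : {p : Fin 3 → X // Injective p}) :
    g • ofInjective p = ofInjective ⟨g • p.1, (MulAction.injective g).comp p.2⟩ :=
  Subtype.ext (Set.range_comp (g • ·) p.1).symm

end

variable {G X : Type*} [TopologicalSpace X]

theorem continuous_ofInjective : Continuous (ofInjective (X := X)) :=
  continuous_coinduced_rng

/-- The saturation of an open set is the union of its preimages under the permutations of
coordinates. -/
theorem isOpenMap_ofInjective : IsOpenMap (ofInjective (X := X)) := by
  intro V hV
  have key : ofInjective ⁻¹' (ofInjective '' V) = ⋃ σ : Equiv.Perm (Fin 3),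
      (fun p : {p : Fin 3 → X // Injective p} =>
        (⟨p.1 ∘ σ, p.2.comp σ.injective⟩ : {p : Fin 3 → X // Injective p})) ⁻¹' V := by
    ext p
    simp only [mem_preimage, mem_image, mem_iUnion]
    constructor
    · rintro ⟨q, hq, hqp⟩
      have hr : range q.1 = range p.1 := congrArg Subtype.val hqp
      refine ⟨(Equiv.ofInjective q.1 q.2).trans
        ((Equiv.setCongr hr).trans (Equiv.ofInjective p.1 p.2).symm), ?_⟩
      convert hq
      ext i
      simp [Equiv.apply_ofInjective_symm]
    · rintro ⟨σ, hσ⟩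
      exact ⟨_, hσ, Subtype.ext (σ.surjective.range_comp p.1)⟩
  refine isOpen_coinduced.2 ?_
  rw [key]
  refine isOpen_iUnion fun σ => hV.preimage (Continuous.subtype_mk ?_ _)
  exact continuous_pi fun i => (continuous_apply (σ i)).comp continuous_subtype_val

theorem isOpenQuotientMap_ofInjective : IsOpenQuotientMap (ofInjective (X := X)) :=
  ⟨surjective_ofInjective, continuous_ofInjective, isOpenMap_ofInjective⟩

variable [Group G] [MulAction G X]

instance [TopologicalSpace G] [ContinuousSMul G X] : ContinuousSMul G (RegularTriple X) where
  continuous_smul := by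
    have h : IsOpenQuotientMap (Prod.map id ofInjective :
        G × {p : Fin 3 → X // Injective p} → G × RegularTriple X) :=
      IsOpenQuotientMap.id.prodMap isOpenQuotientMap_ofInjective
    rw [← h.continuous_comp_iff]
    have : (fun p : G × RegularTriple X => p.1 • p.2) ∘ Prod.map id ofInjective =
        fun p : G × {p : Fin 3 → X // Injective p} =>
          ofInjective ⟨p.1 • p.2.1, (MulAction.injective p.1).comp p.2.2⟩ :=
      funext fun p => smul_ofInjective p.1 p.2
    rw [this]
    exact continuous_ofInjective.comp (Continuous.subtype_mk
      (continuous_fst.smul (continuous_subtype_val.comp continuous_snd)) _)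

end RegularTriple

section

open RegularTriple

variable {G X : Type*} [Group G] [TopologicalSpace G] [TopologicalSpace X] [T2Space X]
  [MulAction G X]

/-- Let t and gt converge to triples. If g has no limit, at least two points of the limit of t
differ from r, so two points of the limit of gt coincide with a, which is absurd. -/
theorem HasConvergenceDynamics.isProperOnTriples [ContinuousSMul G X]
    (h : HasConvergenceDynamics G X) :
    IsProperOnTriples G X := by
  refine properSMul_iff_continuousSMul_ultrafilter_tendsto.2 ⟨inferInstance, fun V t s hts => ?_⟩
  rw [nhds_prod_eq, tendsto_prod_iff'] at hts
  obtain ⟨p, rfl⟩ := surjective_ofInjective s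
  obtain ⟨q, rfl⟩ := surjective_ofInjective t
  obtain ⟨P, hP1, hP2, hP⟩ := exists_ultrafilter_lift isOpenMap_ofInjective V hts.2
  obtain ⟨Q, hQ1, hQ2, hQ⟩ := exists_ultrafilter_lift isOpenMap_ofInjective P (hts.1.comp hP1)
  let γ (z : ((G × RegularTriple X) × {p : Fin 3 → X // Injective p}) ×
    {p : Fin 3 → X // Injective p}) : G := z.1.1.1
  let p' (i : Fin 3) (z : ((G × RegularTriple X) × {p : Fin 3 → X // Injective p}) ×
    {p : Fin 3 → X // Injective p}) : X := z.1.2.1 i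
  let q' (i : Fin 3) (z : ((G × RegularTriple X) × {p : Fin 3 → X // Injective p}) ×
    {p : Fin 3 → X // Injective p}) : X := z.2.1 i
  have hVQ : Tendsto γ Q (map Prod.fst (V : Filter (G × RegularTriple X))) :=
    tendsto_map.comp (hP1.comp hQ1)
  have hp : ∀ i, Tendsto (p' i) Q (𝓝 (p.1 i)) := fun i =>
    (((continuous_apply i).comp continuous_subtype_val).tendsto p).comp (hP2.comp hQ1)
  have hq : ∀ i, Tendsto (q' i) Q (𝓝 (q.1 i)) := fun i =>
    (((continuous_apply i).comp continuous_subtype_val).tendsto q).comp hQ2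
  have hpq : ∀ j, ∃ i, ∀ᶠ z in Q, q' j z = γ z • p' i z := by
    intro j
    rw [← Ultrafilter.eventually_exists_iff]
    filter_upwards [hQ, hQ1.eventually hP] with z hz hz'
    have : z.2.1 j ∈ (ofInjective z.2).1 := mem_range_self j
    rw [hz] at this
    simp only [comp_apply] at this
    rw [← hz', smul_ofInjective] at this
    obtain ⟨i, hi⟩ := this
    exact ⟨i, hi.symm⟩
  choose σ hσ using hpq
  have hσi : Injective σ := by
    intro j j' hj
    obtain ⟨z, hz, hz'⟩ := ((hσ j).and (hσ j')).exists
    exact z.2.2 (hz.trans ((congrArg (γ z • p' · z) hj).trans hz'.symm))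
  by_cases hlim : ∃ g, ((V.map Prod.fst : Ultrafilter G) : Filter G) ≤ 𝓝 g
  · obtain ⟨g, hg⟩ := hlim
    refine ⟨g, Subtype.ext ?_, hg⟩
    have hsub : range q.1 ⊆ (g • ofInjective p).1 := by
      rintro _ ⟨j, rfl⟩
      rw [smul_ofInjective]
      exact ⟨σ j, (tendsto_nhds_unique ((hq j).congr' (hσ j))
        ((hVQ.mono_right hg).smul (hp (σ j)))).symm⟩
    have hfin : (g • ofInjective p).1.Finite := Set.finite_of_ncard_ne_zero (by
      rw [(g • ofInjective p).2]; decide)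
    exact (Set.eq_of_subset_of_ncard_le hsub (by
      rw [(g • ofInjective p).2]; exact (ofInjective q).2.ge) hfin).symm
  · push Not at hlim
    obtain ⟨a, r, har⟩ := h _ hlim
    have har' : Attracts (map γ Q) a r := fun x hx =>
      (har x hx).mono_left (Filter.prod_mono hVQ le_rfl)
    obtain ⟨i, j, hij, hi, hj⟩ := exists_ne_ne_of_injective_fin_three (p.2.comp hσi) r
    have key : ∀ i, p.1 (σ i) ≠ r → q.1 i = a := fun i hi =>
      tendsto_nhds_unique ((hq i).congr' (hσ i)) (har'.tendsto (hp (σ i)) hi)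
    exact absurd (q.2 ((key i hi).trans (key j hj).symm)) hij

/-- Relate x to the cluster points of gx' as g follows `U` and x' → x. Compactness makes this
relation total on both sides; three pairs in general position would, by properness, give `U` a
limit. So the relation lies in a cross, which names a and r. -/
theorem IsProperOnTriples.hasConvergenceDynamics [CompactSpace X] (hcard : 3 ≤ ENat.card X)
    (h : IsProperOnTriples G X) : HasConvergenceDynamics G X := by
  intro U hU
  have hlim : ∀ Q : Ultrafilter (G × X), ∃ y,
      Tendsto (fun p : G × X => p.1 • p.2) (Q : Filter (G × X)) (𝓝 y) := fun Q => by
    obtain ⟨y, -, hy⟩ := isCompact_univ.ultrafilter_le_nhds (Q.map fun p => p.1 • p.2) (by simp)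
    exact ⟨y, hy⟩
  have hcross : ∃ a r, ∀ x y, MapClusterPt y ((U : Filter G) ×ˢ 𝓝 x)
      (fun p : G × X => p.1 • p.2) → x ≠ r → y = a := by
    refine exists_cross hcard ?_ ?_ ?_
    · intro x
      obtain ⟨Q, hQ⟩ := Ultrafilter.exists_le ((U : Filter G) ×ˢ 𝓝 x)
      obtain ⟨y, hy⟩ := hlim Q
      exact ⟨y, mapClusterPt_iff_ultrafilter.2 ⟨Q, hQ, hy⟩⟩
    · intro y
      obtain ⟨x, -, hx⟩ := isCompact_univ.ultrafilter_le_nhds (U.map fun g => g⁻¹ • y) (by simp)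
      refine ⟨x, mapClusterPt_iff_ultrafilter.2 ⟨U.map fun g => (g, g⁻¹ • y), ?_, ?_⟩⟩
      · exact tendsto_id.prodMk hx
      · rw [Ultrafilter.coe_map, tendsto_map'_iff]
        exact tendsto_const_nhds.congr fun g => by simp
    · intro x y hx hy hxy
      have hcl : MapClusterPt y ((U : Filter G) ×ˢ 𝓝 x)
          (fun p : G × (Fin 3 → X) => p.1 • p.2) := by
        rw [mapClusterPt_iff_frequently]
        intro M hM
        rw [nhds_pi, Filter.mem_pi'] at hM
        obtain ⟨I, M', hM', hMM⟩ := hM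
        rw [frequently_iff]
        intro S hS
        obtain ⟨A, hA, N, hN, hAN⟩ := mem_prod_iff.1 hS
        rw [nhds_pi, Filter.mem_pi'] at hN
        obtain ⟨J, N', hN', hNN⟩ := hN
        -- As `U` is an ultrafilter, frequent events are eventual, so one g serves all three
        -- coordinates.
        have hi : ∀ i, ∀ᶠ g in (U : Filter G), ∃ z ∈ N' i, g • z ∈ M' i := by
          intro i
          rw [← Ultrafilter.frequently_iff_eventually]
          intro hcon
          refine ((hxy i).frequently (hM' i)) ?_
          filter_upwards [prod_mem_prod hcon (hN' i)] with p hp hpM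
          exact hp.1 ⟨p.2, hp.2, hpM⟩
        obtain ⟨g, hgA, hg⟩ := (Filter.Eventually.and hA (eventually_all.2 hi)).exists
        choose z hzN hzM using hg
        exact ⟨(g, z), hAN ⟨hgA, hNN fun i _ => hzN i⟩, hMM fun i _ => hzM i⟩
      obtain ⟨Q, hQ, hQy⟩ := mapClusterPt_iff_ultrafilter.1 hcl
      have hQ1 : Tendsto Prod.fst (Q : Filter (G × (Fin 3 → X))) U := tendsto_fst.mono_left hQ
      have hQ2 : Tendsto Prod.snd (Q : Filter (G × (Fin 3 → X))) (𝓝 x) := tendsto_snd.mono_left hQ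
      have hinj : Injective (Prod.map id Subtype.val :
          G × {p : Fin 3 → X // Injective p} → G × (Fin 3 → X)) :=
        injective_id.prodMap Subtype.val_injective
      have hlarge : range (Prod.map id Subtype.val :
          G × {p : Fin 3 → X // Injective p} → G × (Fin 3 → X)) ∈ Q := by
        filter_upwards [hQ2.eventually (eventually_injective hx)] with p hp
        exact ⟨(p.1, ⟨p.2, hp⟩), rfl⟩
      have hQ' : Tendsto (Prod.map id Subtype.val) (Q.comap hinj hlarge : Filter (G × {p : Fin 3 → X // Injective p}))
          (Q : Filter (G × (Fin 3 → X))) := by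
        rw [Ultrafilter.coe_comap]
        exact tendsto_comap
      obtain ⟨g, -, hg⟩ := (properSMul_iff_continuousSMul_ultrafilter_tendsto.1 h).2
        ((Q.comap hinj hlarge).map (Prod.map id ofInjective)) (ofInjective ⟨y, hy⟩)
        (ofInjective ⟨x, hx⟩) (by
          rw [Ultrafilter.coe_map, tendsto_map'_iff, nhds_prod_eq]
          refine Tendsto.prodMk ?_ ?_
          · refine Tendsto.congr (fun p => (smul_ofInjective p.1 p.2).symm)
              ((continuous_ofInjective.tendsto _).comp ?_)
            exact tendsto_subtype_rng.2 (hQy.comp hQ')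
          · refine (continuous_ofInjective.tendsto _).comp ?_
            exact tendsto_subtype_rng.2 (hQ2.comp hQ'))
      rw [Ultrafilter.coe_map, tendsto_map'_iff] at hg
      refine hU g ?_
      have := (Ultrafilter.eq_of_le (f := (Q.comap hinj hlarge).map Prod.fst) (g := U)
        (hQ1.comp hQ'))
      exact this ▸ hg
  obtain ⟨a, r, har⟩ := hcross
  refine ⟨a, r, fun x hx => ?_⟩
  rw [tendsto_iff_ultrafilter]
  intro Q hQ
  obtain ⟨y, hy⟩ := hlim Q
  exact har x y (mapClusterPt_iff_ultrafilter.2 ⟨Q, hQ, hy⟩) hx ▸ hy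

end

/-! ### Ultrafilters on Ω escaping to Λ -/

theorem Ultrafilter.exists_tendsto_of_eventually_mem {ι X : Type*} [TopologicalSpace X]
    (P : Ultrafilter ι) {K : Set X} (hK : IsCompact K) {f : ι → X} (hf : ∀ᶠ i in P, f i ∈ K) :
    ∃ x ∈ K, Tendsto f P (𝓝 x) :=
  hK.ultrafilter_le_nhds (P.map f) (le_principal_iff.2 hf)

theorem Ultrafilter.exists_tendsto {ι X : Type*} [TopologicalSpace X] [CompactSpace X]
    (P : Ultrafilter ι) (f : ι → X) : ∃ x, Tendsto f P (𝓝 x) := by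
  obtain ⟨x, -, hx⟩ := P.exists_tendsto_of_eventually_mem isCompact_univ (f := f) (by simp)
  exact ⟨x, hx⟩

theorem Ultrafilter.eventuallyEq_inl_or_inr {ι A B : Type*} (P : Ultrafilter ι) (f : ι → A ⊕ B) :
    (∃ z : ι → A, ∀ᶠ i in P, f i = Sum.inl (z i)) ∨
      ∃ z : ι → B, ∀ᶠ i in P, f i = Sum.inr (z i) := by
  have h : ∀ᶠ i in P, (∃ a, f i = Sum.inl a) ∨ ∃ b, f i = Sum.inr b :=
    Eventually.of_forall fun i => by cases f i <;> simp
  rcases Ultrafilter.eventually_or.1 h with h | h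
  · obtain ⟨-, c, -⟩ := h.exists
    have : Nonempty A := ⟨c⟩
    exact Or.inl h.choice
  · obtain ⟨-, c, -⟩ := h.exists
    have : Nonempty B := ⟨c⟩
    exact Or.inr h.choice

/-- A choice, for each point of `Ω`, of an element of `G` moving it from a given compact set. -/
structure OrbitSection (G Ω : Type*) [Group G] [TopologicalSpace Ω] [MulAction G Ω] where
  toFun : Ω → G
  carrier : Set Ω
  isCompact : IsCompact carrier
  mem : ∀ ω, (toFun ω)⁻¹ • ω ∈ carrier

theorem IsCocompactAction.nonempty_orbitSection {G Ω : Type*} [Group G] [TopologicalSpace Ω]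
    [MulAction G Ω] (h : IsCocompactAction G Ω) : Nonempty (OrbitSection G Ω) := by
  obtain ⟨K, hK, hKu⟩ := h
  have : ∀ ω : Ω, ∃ g : G, g⁻¹ • ω ∈ K := fun ω => by
    obtain ⟨g, hg⟩ := mem_iUnion.1 (hKu ▸ mem_univ ω : ω ∈ ⋃ g : G, g • K)
    exact ⟨g, mem_smul_set_iff_inv_smul_mem.1 hg⟩
  choose γ hγ using this
  exact ⟨⟨γ, K, hK, hγ⟩⟩

section

variable {ι G Λ Ω : Type*} [Group G]
  [TopologicalSpace Λ] [MulAction G Λ]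
  [TopologicalSpace Ω] [MulAction G Ω] {P : Ultrafilter ι}

/-- The ultrafilter `H` on `Ω` escapes to the point `a` of `Λ`. -/
def EscapesTo (σ : OrbitSection G Ω) (H : Ultrafilter Ω) (a : Λ) : Prop :=
  ∃ r : Λ, Attracts (map σ.toFun (H : Filter Ω)) a r

variable {σ : OrbitSection G Ω} {H : Ultrafilter Ω} {a b : Λ}

theorem EscapesTo.unique [T2Space Λ] (hcard : 3 ≤ ENat.card Λ) (ha : EscapesTo σ H a)
    (hb : EscapesTo σ H b) : a = b := by
  obtain ⟨r, hr⟩ := ha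
  obtain ⟨s, hs⟩ := hb
  exact hr.unique hcard hs

variable [TopologicalSpace G]

/-- If σ(ω) converged along `H`, so would ω = σ(ω)(σ(ω)⁻¹ω), the second factor having a limit in the
compact carrier. -/
theorem exists_escapesTo [ContinuousSMul G Ω] (σ : OrbitSection G Ω)
    (hΛ : HasConvergenceDynamics G Λ) (hH : ∀ ω, ¬ (H : Filter Ω) ≤ 𝓝 ω) :
    ∃ a : Λ, EscapesTo σ H a := by
  refine hΛ (H.map σ.toFun) fun g hg => ?_
  obtain ⟨y, -, hy⟩ := H.exists_tendsto_of_eventually_mem σ.isCompact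
    (Eventually.of_forall σ.mem)
  have := Tendsto.smul (show Tendsto σ.toFun (H : Filter Ω) (𝓝 g) from hg) hy
  simp only [smul_inv_smul] at this
  exact hH _ this

theorem exists_tendsto_of_properSMul [ProperSMul G Ω] {g : ι → G} {z : ι → Ω} {x y : Ω}
    (hz : Tendsto z P (𝓝 x)) (hgz : Tendsto (fun i => g i • z i) P (𝓝 y)) :
    ∃ k, Tendsto g P (𝓝 k) := by
  obtain ⟨k, -, hk⟩ := (properSMul_iff_continuousSMul_ultrafilter_tendsto.1 ‹ProperSMul G Ω›).2
    (P.map fun i => (g i, z i)) y x (by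
      rw [Ultrafilter.coe_map, tendsto_map'_iff, nhds_prod_eq]
      exact hgz.prodMk hz)
  exact ⟨k, hk⟩

/-- By properness γ⁻¹δ converges, and δ = γ(γ⁻¹δ). Hence the attracting point does not depend on the
choice of elements bringing w back. -/
theorem Attracts.exists_of_tendsto [ContinuousSMul G Λ] [ProperSMul G Ω] {γ δ : ι → G}
    {w : ι → Ω} {x y : Ω} {a r : Λ} (h : Attracts (map γ P) a r)
    (hγ : Tendsto (fun i => (γ i)⁻¹ • w i) P (𝓝 x))
    (hδ : Tendsto (fun i => (δ i)⁻¹ • w i) P (𝓝 y)) : ∃ s, Attracts (map δ P) a s := by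
  obtain ⟨k, hk⟩ := exists_tendsto_of_properSMul (g := fun i => (γ i)⁻¹ * δ i) hδ
    (hγ.congr fun i => by rw [smul_smul, mul_inv_cancel_right])
  have := h.mul_right hk
  simp only [mul_inv_cancel_left] at this
  exact ⟨_, this⟩

theorem EscapesTo.of_attracts [ContinuousSMul G Λ] [ProperSMul G Ω] {γ : ι → G} {w : ι → Ω} {r : Λ}
    (h : Attracts (map γ P) a r) {L : Set Ω} (hL : IsCompact L)
    (hγ : ∀ᶠ i in P, (γ i)⁻¹ • w i ∈ L) : EscapesTo σ (P.map w) a := by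
  obtain ⟨x, -, hx⟩ := P.exists_tendsto_of_eventually_mem hL hγ
  obtain ⟨y, -, hy⟩ := P.exists_tendsto_of_eventually_mem σ.isCompact
    (Eventually.of_forall fun i => σ.mem (w i))
  exact h.exists_of_tendsto hx hy

theorem EscapesTo.smul [ContinuousSMul G Λ] [ProperSMul G Ω] {g : ι → G} {w : ι → Ω} {k : G}
    (h : EscapesTo σ (P.map w) a) (hg : Tendsto g P (𝓝 k)) :
    EscapesTo σ (P.map fun i => g i • w i) (k • a) := by
  obtain ⟨r, hr⟩ := h
  have hr' : Attracts (map (fun i => σ.toFun (w i)) (P : Filter ι)) a r := hr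
  refine EscapesTo.of_attracts (hr'.mul_left hg) σ.isCompact (Eventually.of_forall fun i => ?_)
  rw [mul_inv_rev, smul_smul, inv_mul_cancel_right]
  exact σ.mem _

theorem EscapesTo.not_le_nhds [IsTopologicalGroup G] [T2Space Λ] [ContinuousSMul G Λ]
    [ProperSMul G Ω]
    (hcard : 3 ≤ ENat.card Λ) (ha : EscapesTo σ H a) (ω : Ω) : ¬ (H : Filter Ω) ≤ 𝓝 ω := by
  intro hω
  obtain ⟨r, hr⟩ := ha
  obtain ⟨y, -, hy⟩ := H.exists_tendsto_of_eventually_mem σ.isCompact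
    (Eventually.of_forall σ.mem)
  obtain ⟨k, hk⟩ := exists_tendsto_of_properSMul (show Tendsto id (H : Filter Ω) (𝓝 ω) from hω) hy
  refine hr.not_tendsto hcard (k := k⁻¹) ?_
  simpa using hk.inv

end

/-! ### Uniqueness of the topology -/

section Uniqueness

variable {G Λ Ω X : Type*} [Group G] [TopologicalSpace G]
  [TopologicalSpace Λ] [CompactSpace Λ] [T2Space Λ] [MulAction G Λ] [ContinuousSMul G Λ]
  [TopologicalSpace Ω] [MulAction G Ω] [ProperSMul G Ω]
  [TopologicalSpace X] [CompactSpace X] [T2Space X] [MulAction G X]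

theorem escapesTo_of_tendsto {σ : OrbitSection G Ω} (hcard : 3 ≤ ENat.card Λ)
    (hΛ : HasConvergenceDynamics G Λ) (hX : HasConvergenceDynamics G X)
    {i : Λ → X} (hi : Continuous i) (hi' : Injective i) (hig : ∀ (g : G) x, i (g • x) = g • i x)
    {j : Ω → X} (hj : Continuous j) (hjg : ∀ (g : G) ω, j (g • ω) = g • j ω)
    (hij : ∀ x ω, j ω ≠ i x) {H : Ultrafilter Ω} {b : Λ}
    (hH : ∀ ω, ¬ (H : Filter Ω) ≤ 𝓝 ω) (hb : Tendsto j H (𝓝 (i b))) : EscapesTo σ H b := by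
  obtain ⟨a, ha⟩ := exists_escapesTo σ hΛ hH
  obtain ⟨r, hr⟩ := id ha
  obtain ⟨A, R, hAR⟩ := hX (H.map σ.toFun) fun g => hr.not_tendsto hcard
  rw [Ultrafilter.coe_map] at hAR
  have hne : ∀ (x : Λ) (y : X), ∃ z, z ≠ x ∧ i z ≠ y := by
    intro x y
    by_cases hy : ∃ z, i z = y
    · obtain ⟨z, rfl⟩ := hy
      obtain ⟨u, hux, huz⟩ := ENat.exists_ne_ne_of_three_le hcard x z
      exact ⟨u, hux, hi'.ne huz⟩
    · obtain ⟨u, hux, -⟩ := ENat.exists_ne_ne_of_three_le hcard x x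
      exact ⟨u, hux, fun h => hy ⟨u, h⟩⟩
  have hA : i a = A := by
    obtain ⟨x, hxr, hxR⟩ := hne r R
    refine tendsto_nhds_unique (((hi.tendsto a).comp (hr.tendsto_const hxr)).congr fun ω => ?_)
      (hAR.tendsto_const hxR)
    exact hig _ _
  -- The inverses attract X to R, and the image of Λ is closed and invariant.
  obtain ⟨s, rfl⟩ : R ∈ range i := by
    obtain ⟨x, -, hx⟩ := hne a A
    refine (isCompact_range hi).isClosed.mem_of_tendsto (hAR.inv.tendsto_const hx)
      (Eventually.of_forall fun ω => ?_)
    exact ⟨(σ.toFun ω)⁻¹ • x, hig _ _⟩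
  obtain ⟨k, -, hk⟩ := H.exists_tendsto_of_eventually_mem σ.isCompact
    (Eventually.of_forall σ.mem)
  have hlim := hAR.tendsto ((hj.tendsto k).comp hk) (hij s k)
  have : i b = A := tendsto_nhds_unique hb (hlim.congr fun ω => by
    rw [comp_apply, ← hjg, smul_inv_smul])
  rwa [hi' (this.trans hA.symm)]

/-- An ultrafilter with a limit in Λ or in Ω has the same limit in both spaces; any other lives on Ω
and can only converge to the point it escapes to. The maps e and f keep two topologies on one set
apart. -/
theorem tendsto_sum_of_tendsto {Y : Type*}
    [TopologicalSpace Y] [CompactSpace Y] [T2Space Y] [MulAction G Y]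
    (σ : OrbitSection G Ω) (hcard : 3 ≤ ENat.card Λ) (hΛ : HasConvergenceDynamics G Λ)
    (hX : HasConvergenceDynamics G X) (hY : HasConvergenceDynamics G Y)
    {e : Λ ⊕ Ω → X} (he : Bijective e) (heg : ∀ (g : G) s, e (g • s) = g • e s)
    (hel : IsInducing (e ∘ Sum.inl)) (her : IsInducing (e ∘ Sum.inr))
    {f : Λ ⊕ Ω → Y} (hf : Bijective f) (hfg : ∀ (g : G) s, f (g • s) = g • f s)
    (hfl : IsInducing (f ∘ Sum.inl)) (hfr : IsInducing (f ∘ Sum.inr))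
    {Q : Ultrafilter (Λ ⊕ Ω)} {s : Λ ⊕ Ω} (h : Tendsto e Q (𝓝 (e s))) :
    Tendsto f Q (𝓝 (f s)) := by
  rcases Q.eventuallyEq_inl_or_inr id with ⟨z, hz⟩ | ⟨w, hw⟩
  · obtain ⟨b, hb⟩ := Q.exists_tendsto z
    have h1 : Tendsto e Q (𝓝 (e (Sum.inl b))) :=
      ((hel.continuous.tendsto b).comp hb).congr' (hz.mono fun t ht => congrArg e ht.symm)
    rw [he.1 (tendsto_nhds_unique h h1)]
    exact ((hfl.continuous.tendsto b).comp hb).congr' (hz.mono fun t ht => congrArg f ht.symm)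
  · by_cases hlim : ∃ ω, Tendsto w Q (𝓝 ω)
    · obtain ⟨b, hb⟩ := hlim
      have h1 : Tendsto e Q (𝓝 (e (Sum.inr b))) :=
        ((her.continuous.tendsto b).comp hb).congr' (hw.mono fun t ht => congrArg e ht.symm)
      rw [he.1 (tendsto_nhds_unique h h1)]
      exact ((hfr.continuous.tendsto b).comp hb).congr' (hw.mono fun t ht => congrArg f ht.symm)
    · push Not at hlim
      obtain ⟨y, hy⟩ := Q.exists_tendsto f
      obtain ⟨t, rfl⟩ := hf.2 y
      have h1 : Tendsto ((e ∘ Sum.inr) ∘ w) Q (𝓝 (e s)) :=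
        h.congr' (hw.mono fun t ht => congrArg e ht)
      have h2 : Tendsto ((f ∘ Sum.inr) ∘ w) Q (𝓝 (f t)) :=
        hy.congr' (hw.mono fun t ht => congrArg f ht)
      rcases s with b | ω
      · rcases t with c | ω
        · have hb : EscapesTo σ (Q.map w) b :=
            escapesTo_of_tendsto hcard hΛ hX hel.continuous (he.1.comp Sum.inl_injective)
              (fun g x => heg g (Sum.inl x)) her.continuous (fun g x => heg g (Sum.inr x))
              (fun x ω h => Sum.inr_ne_inl (he.1 h)) hlim h1
          have hc : EscapesTo σ (Q.map w) c :=
            escapesTo_of_tendsto hcard hΛ hY hfl.continuous (hf.1.comp Sum.inl_injective)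
              (fun g x => hfg g (Sum.inl x)) hfr.continuous (fun g x => hfg g (Sum.inr x))
              (fun x ω h => Sum.inr_ne_inl (hf.1 h)) hlim h2
          rwa [hb.unique hcard hc]
        · exact absurd (hfr.tendsto_nhds_iff.2 h2) (hlim ω)
      · exact absurd (her.tendsto_nhds_iff.2 h1) (hlim ω)

end Uniqueness

/-! ### Construction of the topology -/

/-- The disjoint union of `Λ` and `Ω`, with the topology in which a set is open if it meets `Λ` and
`Ω` in open sets and belongs to each ultrafilter on `Ω` escaping to one of its points. -/
def AttractorSum {G Ω : Type*} (Λ : Type*) [Group G] [TopologicalSpace Ω] [MulAction G Ω]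
    (_ : OrbitSection G Ω) : Type _ :=
  Λ ⊕ Ω

namespace AttractorSum

variable {ι G Λ Ω : Type*} [Group G] [TopologicalSpace Ω] [MulAction G Ω]
  {σ : OrbitSection G Ω} {P : Ultrafilter ι}

def inl (x : Λ) : AttractorSum Λ σ := Sum.inl x

def inr (ω : Ω) : AttractorSum Λ σ := Sum.inr ω

theorem inl_injective : Injective (inl : Λ → AttractorSum Λ σ) := Sum.inl_injective

theorem inr_injective : Injective (inr : Ω → AttractorSum Λ σ) := Sum.inr_injective

theorem inr_ne_inl {ω : Ω} {x : Λ} : (inr ω : AttractorSum Λ σ) ≠ inl x := Sum.inr_ne_inl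

theorem eq_inl_or_inr (s : AttractorSum Λ σ) : (∃ x, s = inl x) ∨ ∃ ω, s = inr ω := by
  rcases s with x | ω
  exacts [Or.inl ⟨x, rfl⟩, Or.inr ⟨ω, rfl⟩]

theorem eventuallyEq_inl_or_inr (P : Ultrafilter ι) (f : ι → AttractorSum Λ σ) :
    (∃ z : ι → Λ, ∀ᶠ i in P, inl (z i) = f i) ∨ ∃ z : ι → Ω, ∀ᶠ i in P, inr (z i) = f i := by
  simpa only [eq_comm] using! P.eventuallyEq_inl_or_inr f

variable [MulAction G Λ]

instance : MulAction G (AttractorSum Λ σ) :=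
  inferInstanceAs (MulAction G (Λ ⊕ Ω))

theorem smul_inl (g : G) (x : Λ) : g • (inl x : AttractorSum Λ σ) = inl (g • x) := rfl

theorem smul_inr (g : G) (ω : Ω) : g • (inr ω : AttractorSum Λ σ) = inr (g • ω) := rfl

variable [TopologicalSpace Λ]

instance instTopologicalSpace : TopologicalSpace (AttractorSum Λ σ) where
  IsOpen V := IsOpen (inl ⁻¹' V) ∧ IsOpen (inr ⁻¹' V) ∧
    ∀ (H : Ultrafilter Ω) (a : Λ), EscapesTo σ H a → inl a ∈ V → inr ⁻¹' V ∈ H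
  isOpen_univ := ⟨isOpen_univ, isOpen_univ, fun _ _ _ _ => univ_mem⟩
  isOpen_inter V W hV hW := ⟨hV.1.inter hW.1, hV.2.1.inter hW.2.1, fun H a h ha =>
    inter_mem (hV.2.2 H a h ha.1) (hW.2.2 H a h ha.2)⟩
  isOpen_sUnion S hS := by
    refine ⟨?_, ?_, fun H a h ⟨V, hV, ha⟩ =>
      mem_of_superset ((hS V hV).2.2 H a h ha) fun ω hω => ⟨V, hV, hω⟩⟩
    · rw [preimage_sUnion]
      exact isOpen_biUnion fun V hV => (hS V hV).1
    · rw [preimage_sUnion]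
      exact isOpen_biUnion fun V hV => (hS V hV).2.1

theorem isOpen_iff {V : Set (AttractorSum Λ σ)} : IsOpen V ↔
    IsOpen (inl ⁻¹' V) ∧ IsOpen (inr ⁻¹' V) ∧
      ∀ (H : Ultrafilter Ω) (a : Λ), EscapesTo σ H a → inl a ∈ V → inr ⁻¹' V ∈ H :=
  Iff.rfl

theorem continuous_inl : Continuous (inl : Λ → AttractorSum Λ σ) :=
  continuous_def.2 fun _ hV => hV.1

theorem isOpenEmbedding_inr : IsOpenEmbedding (inr : Ω → AttractorSum Λ σ) := by
  refine .of_continuous_injective_isOpenMap (continuous_def.2 fun _ hV => hV.2.1)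
    inr_injective fun V hV => isOpen_iff.2 ⟨?_, ?_, ?_⟩
  · convert isOpen_empty
    ext x
    simp [inr_ne_inl]
  · rwa [preimage_image_eq _ inr_injective]
  · rintro H a - ⟨ω, -, hω⟩
    exact absurd hω inr_ne_inl

theorem tendsto_inr_of_escapesTo {w : ι → Ω} {a : Λ} (h : EscapesTo σ (P.map w) a) :
    Tendsto (fun i => (inr (w i) : AttractorSum Λ σ)) P (𝓝 (inl a)) :=
  tendsto_nhds.2 fun _ hV ha => hV.2.2 _ a h ha

theorem exists_of_tendsto_inl [CompactSpace Λ] [T2Space (AttractorSum Λ σ)] {z : ι → Λ}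
    {s : AttractorSum Λ σ} (h : Tendsto (fun i => (inl (z i) : AttractorSum Λ σ)) P (𝓝 s)) :
    ∃ b, s = inl b ∧ Tendsto z P (𝓝 b) := by
  obtain ⟨b, hb⟩ := P.exists_tendsto z
  exact ⟨b, tendsto_nhds_unique h ((continuous_inl.tendsto b).comp hb), hb⟩

variable [TopologicalSpace G]

theorem compactSpace [CompactSpace Λ] [ContinuousSMul G Ω] (hΛ : HasConvergenceDynamics G Λ) :
    CompactSpace (AttractorSum Λ σ) := by
  rw [← isCompact_univ_iff, isCompact_iff_ultrafilter_le_nhds]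
  intro Q _
  rcases eventuallyEq_inl_or_inr Q id with ⟨z, hz⟩ | ⟨w, hw⟩
  · obtain ⟨b, hb⟩ := Q.exists_tendsto z
    exact ⟨inl b, mem_univ _, ((continuous_inl.tendsto b).comp hb).congr' hz⟩
  · by_cases hlim : ∃ ω, Tendsto w Q (𝓝 ω)
    · obtain ⟨ω, hω⟩ := hlim
      exact ⟨inr ω, mem_univ _, ((isOpenEmbedding_inr.continuous.tendsto ω).comp hω).congr' hw⟩
    · push Not at hlim
      obtain ⟨a, ha⟩ := exists_escapesTo (H := Q.map w) σ hΛ hlim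
      exact ⟨inl a, mem_univ _, (tendsto_inr_of_escapesTo ha).congr' hw⟩

variable [ContinuousSMul G Λ] [ProperSMul G Ω]

theorem isOpen_compl_inr_image [IsTopologicalGroup G] [T2Space Λ] [T2Space Ω]
    (hcard : 3 ≤ ENat.card Λ) {C : Set Ω} (hC : IsCompact C) :
    IsOpen (inr '' C : Set (AttractorSum Λ σ))ᶜ := by
  refine isOpen_iff.2 ⟨?_, ?_, fun H a h _ => ?_⟩
  · convert isOpen_univ
    ext x
    simp [inr_ne_inl]
  · rw [preimage_compl, preimage_image_eq _ inr_injective]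
    exact hC.isClosed.isOpen_compl
  · rw [preimage_compl, preimage_image_eq _ inr_injective, Ultrafilter.compl_mem_iff_notMem]
    intro hCH
    obtain ⟨ω, -, hω⟩ := hC.ultrafilter_le_nhds H (le_principal_iff.2 hCH)
    exact h.not_le_nhds hcard ω hω

variable [LocallyCompactSpace Ω]

/-- Each open subset of `Λ` extends by an open subset `W` of `Ω` to an open subset of the sum, such
that the ultrafilters containing `W` escape only to its closure. -/
theorem exists_open_extension (hcard : 3 ≤ ENat.card Λ) {U : Set Λ} (hU : IsOpen U) :
    ∃ W : Set Ω, IsOpen (inl '' U ∪ inr '' W : Set (AttractorSum Λ σ)) ∧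
      ∀ (H : Ultrafilter Ω) (b : Λ), EscapesTo σ H b → W ∈ H → b ∈ closure U := by
  obtain ⟨x, hx⟩ : ∃ x : Fin 3 → Λ, Injective x := by
    obtain ⟨a⟩ : Nonempty Λ := (ENat.one_le_card_iff_nonempty Λ).1 (le_trans (by norm_num) hcard)
    obtain ⟨b, hb, -⟩ := ENat.exists_ne_ne_of_three_le hcard a a
    obtain ⟨c, hc, hc'⟩ := ENat.exists_ne_ne_of_three_le hcard a b
    refine ⟨![a, b, c], ?_⟩
    intro i j; fin_cases i <;> fin_cases j <;> simp_all [eq_comm]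
  obtain ⟨L, hL, hσL⟩ := exists_compact_superset σ.isCompact
  -- Two points out of three: at most one is repelling, so elements attracting to a point of `U`
  -- eventually lie in `T`; conversely, one of the two points moved into `U` is not repelling, so
  -- its images tend to the attracting point.
  let T : Set G := {g | ∃ i j, i ≠ j ∧ g • x i ∈ U ∧ g • x j ∈ U}
  let W : Set Ω := ⋃ g ∈ T, (fun ω => g⁻¹ • ω) ⁻¹' interior L
  have hW : ∀ (H : Ultrafilter Ω) (a : Λ), EscapesTo σ H a → a ∈ U → W ∈ H := by
    rintro H a ⟨r, hr⟩ ha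
    obtain ⟨i, j, hij, hi, hj⟩ := exists_ne_ne_of_injective_fin_three hx r
    filter_upwards [(hr.tendsto_const hi).eventually (hU.mem_nhds ha),
      (hr.tendsto_const hj).eventually (hU.mem_nhds ha)] with ω h1 h2
    exact mem_iUnion₂.2 ⟨σ.toFun ω, ⟨i, j, hij, h1, h2⟩, hσL (σ.mem ω)⟩
  refine ⟨W, isOpen_iff.2 ⟨?_, ?_, ?_⟩, fun H b hb hWH => ?_⟩
  · convert hU
    ext y
    simp [inr_ne_inl, inl_injective.eq_iff]
  · have : (inr ⁻¹' (inl '' U ∪ inr '' W : Set (AttractorSum Λ σ))) = W := by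
      ext y
      simp [inr_ne_inl.symm, inr_injective.eq_iff]
    rw [this]
    exact isOpen_biUnion fun g _ => isOpen_interior.preimage (continuous_const_smul g⁻¹)
  · intro H a h ha
    have ha' : a ∈ U := by simpa [inr_ne_inl, inl_injective.eq_iff] using ha
    exact mem_of_superset (hW H a h ha') fun ω hω => Or.inr ⟨ω, hω, rfl⟩
  · have : ∀ᶠ ω in H, ∃ g ∈ T, g⁻¹ • ω ∈ interior L :=
      mem_of_superset hWH fun ω hω => by simpa [W] using hω
    obtain ⟨γ, hγ⟩ := this.choice
    obtain ⟨k, -, hk⟩ := H.exists_tendsto_of_eventually_mem hL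
      (hγ.mono fun ω hω => interior_subset hω.2)
    obtain ⟨m, -, hm⟩ := H.exists_tendsto_of_eventually_mem σ.isCompact
      (Eventually.of_forall σ.mem)
    obtain ⟨r, hr⟩ := hb
    -- Both γ and σ bring ω back to a compact set, so γ also attracts to b.
    obtain ⟨s, hs⟩ := hr.exists_of_tendsto hm hk
    have hev : ∃ i, x i ≠ s ∧ ∀ᶠ ω in H, γ ω • x i ∈ U := by
      have h' : ∀ᶠ ω in H, ∃ i, x i ≠ s ∧ γ ω • x i ∈ U := by
        filter_upwards [hγ] with ω hω
        obtain ⟨i, j, hij, hi, hj⟩ := hω.1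
        by_cases hs : x i = s
        · exact ⟨j, fun h => hij (hx (hs.trans h.symm)), hj⟩
        · exact ⟨i, hs, hi⟩
      obtain ⟨i, hi⟩ := Ultrafilter.eventually_exists_iff.1 h'
      obtain ⟨_, his, -⟩ := hi.exists
      exact ⟨i, his, hi.mono fun ω hω => hω.2⟩
    obtain ⟨i, his, hi⟩ := hev
    exact mem_closure_of_tendsto (hs.tendsto_const his) hi

theorem isInducing_inl (hcard : 3 ≤ ENat.card Λ) :
    IsInducing (inl : Λ → AttractorSum Λ σ) := by
  refine ⟨le_antisymm continuous_inl.le_induced fun U hU => ?_⟩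
  obtain ⟨W, hW, -⟩ := exists_open_extension (σ := σ) hcard hU
  refine ⟨_, hW, ?_⟩
  ext y
  simp [inr_ne_inl, inl_injective.eq_iff]

variable [IsTopologicalGroup G] [T2Space Λ] [T2Space Ω]

/-- The ultrafilter has no limit in Ω, so it escapes to some c. If c ≠ a, extending a neighbourhood
of a whose closure misses c gives a contradiction. -/
theorem escapesTo_of_tendsto_inr (hcard : 3 ≤ ENat.card Λ) (hΛ : HasConvergenceDynamics G Λ)
    {w : ι → Ω} {a : Λ}
    (h : Tendsto (fun i => (inr (w i) : AttractorSum Λ σ)) P (𝓝 (inl a))) :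
    EscapesTo σ (P.map w) a := by
  obtain ⟨c, hc⟩ := exists_escapesTo (H := P.map w) σ hΛ fun ω hω => by
    obtain ⟨C, hC, hωC⟩ := exists_compact_mem_nhds ω
    obtain ⟨i, hi, hi'⟩ := ((h.eventually ((isOpen_compl_inr_image hcard hC).mem_nhds (by
      simp [inr_ne_inl]))).and (hω hωC)).exists
    exact hi ⟨w i, hi', rfl⟩
  suffices a = c by rwa [this]
  by_contra hac
  obtain ⟨U, hU, haU, hcU⟩ : ∃ U : Set Λ, IsOpen U ∧ a ∈ U ∧ c ∉ closure U := by
    obtain ⟨U, V, hU, hV, ha, hc, hUV⟩ := t2_separation hac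
    exact ⟨U, hU, ha, fun h => disjoint_left.1 (hUV.closure_left hV) h hc⟩
  obtain ⟨W, hW, hWU⟩ := exists_open_extension (σ := σ) hcard hU
  refine hcU (hWU _ c hc ?_)
  refine Ultrafilter.mem_map.2 (mem_of_superset (h (hW.mem_nhds (Or.inl ⟨a, haU, rfl⟩)))
    fun i hi => ?_)
  simpa [inr_ne_inl.symm, inr_injective.eq_iff] using hi

theorem t2Space (hcard : 3 ≤ ENat.card Λ) (hΛ : HasConvergenceDynamics G Λ) :
    T2Space (AttractorSum Λ σ) := by
  have hsep : ∀ (a : Λ) (ω : Ω), ¬ NeBot (𝓝 (inl a : AttractorSum Λ σ) ⊓ 𝓝 (inr ω)) := by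
    intro a ω
    obtain ⟨C, hC, hωC⟩ := exists_compact_mem_nhds ω
    rw [not_neBot, ← disjoint_iff]
    exact Filter.disjoint_iff.2 ⟨_, (isOpen_compl_inr_image hcard hC).mem_nhds (by
      simp [inr_ne_inl]), _, isOpenEmbedding_inr.isOpenMap.image_mem_nhds hωC,
      disjoint_compl_left⟩
  rw [t2_iff_nhds]
  intro s t hst
  rcases eq_inl_or_inr s with ⟨a, rfl⟩ | ⟨ω, rfl⟩ <;>
    rcases eq_inl_or_inr t with ⟨b, rfl⟩ | ⟨ρ, rfl⟩
  · obtain ⟨Q, hQ⟩ := Ultrafilter.exists_le (𝓝 (inl a : AttractorSum Λ σ) ⊓ 𝓝 (inl b))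
    have ha := hQ.trans inf_le_left
    have hb := hQ.trans inf_le_right
    rcases eventuallyEq_inl_or_inr Q id with ⟨z, hz⟩ | ⟨w, hw⟩
    · rw [tendsto_nhds_unique
        ((isInducing_inl hcard).tendsto_nhds_iff.2 (Tendsto.congr' (EventuallyEq.symm hz) ha))
        ((isInducing_inl hcard).tendsto_nhds_iff.2 (Tendsto.congr' (EventuallyEq.symm hz) hb))]
    · rw [(escapesTo_of_tendsto_inr hcard hΛ (Tendsto.congr' (EventuallyEq.symm hw) ha)).unique
        hcard (escapesTo_of_tendsto_inr hcard hΛ (Tendsto.congr' (EventuallyEq.symm hw) hb))]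
  · exact absurd hst (hsep a ρ)
  · exact absurd (inf_comm (𝓝 (inr ω : AttractorSum Λ σ)) _ ▸ hst) (hsep b ω)
  · rw [← isOpenEmbedding_inr.map_nhds_eq, ← isOpenEmbedding_inr.map_nhds_eq,
      ← Filter.map_inf inr_injective, map_neBot_iff] at hst
    rw [eq_of_nhds_neBot hst]

variable [CompactSpace Λ]

theorem continuousSMul (hcard : 3 ≤ ENat.card Λ) (hΛ : HasConvergenceDynamics G Λ) :
    ContinuousSMul G (AttractorSum Λ σ) := by
  have := t2Space (σ := σ) hcard hΛ
  refine ⟨continuous_iff_ultrafilter.2 fun ⟨g, s⟩ Q hQ => ?_⟩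
  have hQ1 : Tendsto Prod.fst (Q : Filter (G × AttractorSum Λ σ)) (𝓝 g) :=
    (continuous_fst.tendsto (g, s)).mono_left hQ
  have hQ2 : Tendsto Prod.snd (Q : Filter (G × AttractorSum Λ σ)) (𝓝 s) :=
    (continuous_snd.tendsto (g, s)).mono_left hQ
  rcases eventuallyEq_inl_or_inr Q Prod.snd with ⟨z, hz⟩ | ⟨w, hw⟩
  · obtain ⟨b, rfl, hb⟩ := exists_of_tendsto_inl (hQ2.congr' (EventuallyEq.symm hz))
    refine ((continuous_inl.tendsto (g • b)).comp (hQ1.smul hb)).congr' ?_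
    filter_upwards [hz] with p hp
    rw [← hp, smul_inl, comp_apply]
  · have hw' := hQ2.congr' (EventuallyEq.symm hw)
    have key : ∀ᶠ p in (Q : Filter (G × AttractorSum Λ σ)), inr (p.1 • w p) = p.1 • p.2 := by
      filter_upwards [hw] with p hp
      rw [← hp, smul_inr]
    rcases eq_inl_or_inr s with ⟨a, rfl⟩ | ⟨ω, rfl⟩
    · exact (tendsto_inr_of_escapesTo
        ((escapesTo_of_tendsto_inr hcard hΛ hw').smul hQ1)).congr' key
    · exact ((isOpenEmbedding_inr.continuous.tendsto (g • ω)).comp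
        (hQ1.smul (isOpenEmbedding_inr.isInducing.tendsto_nhds_iff.2 hw'))).congr' key

theorem hasConvergenceDynamics (hcard : 3 ≤ ENat.card Λ) (hΛ : HasConvergenceDynamics G Λ) :
    HasConvergenceDynamics G (AttractorSum Λ σ) := by
  have := t2Space (σ := σ) hcard hΛ
  intro U hU
  obtain ⟨a, r, har⟩ := hΛ U hU
  refine ⟨inl a, inl r, fun s hs => ?_⟩
  rw [tendsto_iff_ultrafilter]
  intro Q hQ
  have hQ1 : Tendsto Prod.fst (Q : Filter (G × AttractorSum Λ σ)) U := tendsto_fst.mono_left hQ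
  have hQ2 : Tendsto Prod.snd (Q : Filter (G × AttractorSum Λ σ)) (𝓝 s) :=
    tendsto_snd.mono_left hQ
  have har' : Attracts (map Prod.fst (Q : Filter (G × AttractorSum Λ σ))) a r := fun x hx =>
    (har x hx).mono_left (Filter.prod_mono hQ1 le_rfl)
  rcases eventuallyEq_inl_or_inr Q Prod.snd with ⟨z, hz⟩ | ⟨w, hw⟩
  · obtain ⟨b, rfl, hb⟩ := exists_of_tendsto_inl (hQ2.congr' (EventuallyEq.symm hz))
    refine ((continuous_inl.tendsto a).comp
      (har'.tendsto hb fun h => hs (congrArg inl h))).congr' ?_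
    filter_upwards [hz] with p hp
    rw [← hp, smul_inl, comp_apply]
  · have hw' := hQ2.congr' (EventuallyEq.symm hw)
    have key : ∀ᶠ p in (Q : Filter (G × AttractorSum Λ σ)), inr (p.1 • w p) = p.1 • p.2 := by
      filter_upwards [hw] with p hp
      rw [← hp, smul_inr]
    -- The element gσ(w) brings gw back to the carrier. If w tends to b ≠ r in Λ, the two
    -- attractions compose; if w converges in Ω, then σ(w) converges.
    suffices ∃ t, Attracts (map (fun p => p.1 * σ.toFun (w p))
        (Q : Filter (G × AttractorSum Λ σ))) a t by
      obtain ⟨t, ht⟩ := this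
      refine (tendsto_inr_of_escapesTo (EscapesTo.of_attracts ht σ.isCompact
        (Eventually.of_forall fun p => ?_))).congr' key
      rw [mul_inv_rev, smul_smul, inv_mul_cancel_right]
      exact σ.mem _
    rcases eq_inl_or_inr s with ⟨b, rfl⟩ | ⟨ω, rfl⟩
    · obtain ⟨t, ht⟩ := escapesTo_of_tendsto_inr hcard hΛ hw'
      exact ⟨t, har'.mul ht fun h => hs (congrArg inl h)⟩
    · obtain ⟨y, -, hy⟩ := Q.exists_tendsto_of_eventually_mem σ.isCompact
        (Eventually.of_forall fun p => σ.mem (w p))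
      obtain ⟨k, hk⟩ := exists_tendsto_of_properSMul
        (isOpenEmbedding_inr.isInducing.tendsto_nhds_iff.2 hw') hy
      exact ⟨_, har'.mul_right (by simpa using hk.inv)⟩

end AttractorSum

/-! ### The attractor sum theorem -/

theorem mainTheorem2 {G Λ Ω : Type*}
    [Group G] [TopologicalSpace G] [IsTopologicalGroup G] [LocallyCompactSpace G]
    [TopologicalSpace Λ] [CompactSpace Λ] [T2Space Λ]
    [MulAction G Λ] [ContinuousSMul G Λ]
    [TopologicalSpace Ω] [LocallyCompactSpace Ω] [T2Space Ω]
    [MulAction G Ω] [ContinuousSMul G Ω]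
    (hcard : 3 ≤ ENat.card Λ)
    (hΛ : IsProperOnTriples G Λ)
    (hΩ : ProperSMul G Ω)
    (hcoc : IsCocompactAction G Ω) :
    ∃! τ : TopologicalSpace (Λ ⊕ Ω),
      @CompactSpace (Λ ⊕ Ω) τ ∧
      @T2Space (Λ ⊕ Ω) τ ∧
      TopologicalSpace.induced Sum.inl τ = ‹TopologicalSpace Λ› ∧
      TopologicalSpace.induced Sum.inr τ = ‹TopologicalSpace Ω› ∧
      @ContinuousSMul G (Λ ⊕ Ω) _ _ τ ∧
      @IsProperOnTriples G (Λ ⊕ Ω) _ _ τ _ := by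
  have hΛ' := hΛ.hasConvergenceDynamics hcard
  obtain ⟨σ⟩ := hcoc.nonempty_orbitSection
  have hcard' : 3 ≤ ENat.card (Λ ⊕ Ω) :=
    hcard.trans (ENat.card_le_card_of_injective Sum.inl_injective)
  refine existsUnique_of_exists_of_unique ?_ ?_
  · have hc := AttractorSum.compactSpace (σ := σ) hΛ'
    have ht := AttractorSum.t2Space (σ := σ) hcard hΛ'
    have hs := AttractorSum.continuousSMul (σ := σ) hcard hΛ'
    exact ⟨AttractorSum.instTopologicalSpace (σ := σ), hc, ht,
      (AttractorSum.isInducing_inl hcard).eq_induced.symm,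
      AttractorSum.isOpenEmbedding_inr.eq_induced.symm, hs,
      (AttractorSum.hasConvergenceDynamics (σ := σ) hcard hΛ').isProperOnTriples⟩
  -- The two topologies play symmetric roles, so one inequality suffices.
  · have key : ∀ τ₁ τ₂ : TopologicalSpace (Λ ⊕ Ω),
        (@CompactSpace (Λ ⊕ Ω) τ₁ ∧ @T2Space (Λ ⊕ Ω) τ₁ ∧
          TopologicalSpace.induced Sum.inl τ₁ = ‹TopologicalSpace Λ› ∧
          TopologicalSpace.induced Sum.inr τ₁ = ‹TopologicalSpace Ω› ∧
          @ContinuousSMul G (Λ ⊕ Ω) _ _ τ₁ ∧ @IsProperOnTriples G (Λ ⊕ Ω) _ _ τ₁ _) →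
        (@CompactSpace (Λ ⊕ Ω) τ₂ ∧ @T2Space (Λ ⊕ Ω) τ₂ ∧
          TopologicalSpace.induced Sum.inl τ₂ = ‹TopologicalSpace Λ› ∧
          TopologicalSpace.induced Sum.inr τ₂ = ‹TopologicalSpace Ω› ∧
          @ContinuousSMul G (Λ ⊕ Ω) _ _ τ₂ ∧ @IsProperOnTriples G (Λ ⊕ Ω) _ _ τ₂ _) →
        τ₁ ≤ τ₂ := by
      rintro τ₁ τ₂ ⟨c₁, t₁, l₁, r₁, s₁, p₁⟩ ⟨c₂, t₂, l₂, r₂, s₂, p₂⟩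
      rw [le_iff_nhds]
      intro s
      rw [le_iff_ultrafilter]
      intro Q hQ
      exact @tendsto_sum_of_tendsto G Λ Ω (Λ ⊕ Ω) _ _ _ _ _ _ _ _ _ _ τ₁ c₁ t₁ _ (Λ ⊕ Ω) τ₂ c₂ t₂ _
        σ hcard hΛ' (@IsProperOnTriples.hasConvergenceDynamics G (Λ ⊕ Ω) _ _ τ₁ t₁ _ c₁ hcard' p₁)
        (@IsProperOnTriples.hasConvergenceDynamics G (Λ ⊕ Ω) _ _ τ₂ t₂ _ c₂ hcard' p₂)
        id bijective_id (fun _ _ => rfl) (@IsInducing.mk _ _ _ τ₁ _ l₁.symm)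
        (@IsInducing.mk _ _ _ τ₁ _ r₁.symm)
        id bijective_id (fun _ _ => rfl) (@IsInducing.mk _ _ _ τ₂ _ l₂.symm)
        (@IsInducing.mk _ _ _ τ₂ _ r₂.symm) Q s hQ
    exact fun τ₁ τ₂ h₁ h₂ => le_antisymm (key τ₁ τ₂ h₁ h₂) (key τ₂ τ₁ h₂ h₁)
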